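/- Let $S$ be a countable set, $A\subset S\times S$ a set of admissible transitions, $X=\{x\in S^{\mathbb N}: (x_n,x_{n+1})\in A \text{ for all } n\}$ the associated one-sided Markov shift (with the product topology of the discrete topology, and its Borel $\sigma$-algebra), $T:X\to X$ the left shift, and $[a]=\{x\in X: x_0=a\}$ for $a\in S$. Let $\varphi:X\to\mathbb R$ be locally Hölder: there are $K$ and $\theta\in(0,1)$ such that $|\varphi(x)-\varphi(y)|\le K\theta^n$ whenever $n\ge 2$ and $x_i=y_i$ for all $0\le i<n$. Write $\varphi_n=\sum_{k<n}\varphi\circ T^k$ and $(L_\varphi F)(x)=\sum_{Ty=x}e^{\varphi(y)}F(y)$. Assume that $\varphi$ is positive recurrent: there is $\lambda>0$ such that, for every $a\in S$, the sums $Z_n(\varphi,a)=\sum_{x\in[a],\,T^nx=x}e^{\varphi_n(x)}$, and the sums $Z_n^*(\varphi,a)$ of the same terms over those $x$ which moreover satisfy $x_k\ne a$ for $0<k<n$, satisfy $$\limsup_{n\to\infty} Z_n(\varphi,a)^{1/n}=\lambda,\qquad \sum_{n\ge1}\lambda^{-n}Z_n(\varphi,a)=\infty,\qquad \sum_{n\ge1}n\lambda^{-n}Z_n^*(\varphi,a)<\infty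 .$$ Let $m$ be a $T$-invariant probability measure which is a Ruelle–Perron–Frobenius measure of $\varphi$, i.e. $dm=h\,d\nu$ where $h:X\to(0,\infty)$ is continuous with $L_\varphi h=\lambda h$, and $\nu$ is a measure with $\nu([a])<\infty$ for all $a\in S$ and $L_\varphi^*\nu=\lambda\nu$ (that is, $\int L_\varphi F\,d\nu=\lambda\int F\,d\nu$ for all measurable $F\ge0$). Let $\tau\in(0,1)$ and $d(x,y)=\tau^{s(x,y)}$, where $s(x,y)=\min\{n: x_n\ne y_n\}$ (and $d(x,x)=0$). Let $G$ be a locally compact abelian group whose topology is given by an invariant metric $|x-y|$. For $f:X\to G$ and $Z\subset X$ let $Df(Z)\in[0,\infty]$ be the infimum of the $C>0$ for which there is $\Omega\subset Z$ with $m(Z\setminus\Omega)=0$ and $|f(x)-f(y)|\le C\,d(x,y)$ for all $x,y\in\Omega$ (it is $\infty$ if there is no such $C$). **Theorem (positive recurrent Markov shifts).** Let $f:X\to G$ satisfy $\sum_{a\in S}m([a])\,Df([a])<\infty$, and let $u:X\to G$ be a measurable function such that $f=u-u\circ T$ $m$-almost everywhere. Then $Du([a])<\infty$ for every $a\in S$.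 If moreover $T$ is transitive, i.e. for all $a,b\in S$ with $m([a])>0$ and $m([b])>0$ there is $n\ge0$ with $[b]\subset T^n([a])$ modulo an $m$-null set, then $\sum_{a\in S}m([a])\,Du([a])<\infty$. -/

import Mathlib

open MeasureTheory Filter
open scoped ENNReal

noncomputable section

/-- The one-sided Markov shift space with alphabet `S` and admissible transitions `A`. It carries
the topology and the measurable structure induced from the product `ℕ → S`. -/
abbrev MarkovShift {S : Type*} (A : S → S → Prop) : Type _ :=
  {x : ℕ → S // ∀ n, A (x n) (x (n + 1))}

namespace MarkovShift

variable {S : Type*} {A : S → S → Prop}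

/-- The left shift `T`. -/
def shift (x : MarkovShift A) : MarkovShift A :=
  ⟨fun n => x.1 (n + 1), fun n => x.2 (n + 1)⟩

/-- The element `[a] = {x | x₀ = a}` of the natural partition. -/
def cyl (A : S → S → Prop) (a : S) : Set (MarkovShift A) :=
  {x | x.1 0 = a}

open Classical in
/-- The distance `τ ^ s(x, y)`, where `s(x, y)` is the separation time, that is, the first index at
which `x` and `y` differ (and the distance is `0` if `x = y`). -/
def sepDist (τ : ℝ) (x y : MarkovShift A) : ℝ :=
  if x = y then 0 else τ ^ sInf {n : ℕ | x.1 n ≠ y.1 n}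

/-- Local Hölder continuity of a potential: `V_n(φ) ≤ K θ ^ n` for all `n ≥ 2`, where `V_n(φ)` is
the oscillation of `φ` on cylinders of length `n`. Nothing is asked of `V_1` (for a Markov chain,
`φ(x) = log p(x₀, x₁)`, it may be infinite). -/
def IsLocallyHolder (φ : MarkovShift A → ℝ) : Prop :=
  ∃ K θ : ℝ, 0 < θ ∧ θ < 1 ∧ ∀ n : ℕ, 2 ≤ n → ∀ x y : MarkovShift A,
    (∀ i < n, x.1 i = y.1 i) → |φ x - φ y| ≤ K * θ ^ n

/-- `Z_n(φ, a) = ∑ exp (φ_n(x))`, the sum over the `x ∈ [a]` with `T^n x = x`, where `φ_n` is the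
`n`-th Birkhoff sum of `φ`. -/
def partitionFn (φ : MarkovShift A → ℝ) (a : S) (n : ℕ) : ℝ≥0∞ :=
  ∑' x : {x : MarkovShift A // x ∈ cyl A a ∧ shift^[n] x = x},
    ENNReal.ofReal (Real.exp (birkhoffSum shift φ n x.1))

/-- `Z_n^*(φ, a)`: the same sum, over those `x` whose first return to `[a]` is at time `n`. -/
def firstReturnPartitionFn (φ : MarkovShift A → ℝ) (a : S) (n : ℕ) : ℝ≥0∞ :=
  ∑' x : {x : MarkovShift A // x ∈ cyl A a ∧ shift^[n] x = x ∧ ∀ k, 0 < k → k < n → x.1 k ≠ a},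
    ENNReal.ofReal (Real.exp (birkhoffSum shift φ n x.1))

/-- The potential `φ` is positive recurrent, with exponential of the pressure equal to `lam`: for
every state `a`, `lam = limsup Z_n(φ, a) ^ (1 / n)`, `∑ lam⁻ⁿ Z_n(φ, a) = ∞` (recurrence) and
`∑ n lam⁻ⁿ Z_n^*(φ, a) < ∞` (positivity); the sums run over `n ≥ 1`. -/
def IsPositiveRecurrent (φ : MarkovShift A → ℝ) (lam : ℝ) : Prop :=
  0 < lam ∧ ∀ a : S,
    limsup (fun n : ℕ => partitionFn φ a n ^ (1 / (n : ℝ))) atTop = ENNReal.ofReal lam ∧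
    ∑' n : ℕ, partitionFn φ a (n + 1) / ENNReal.ofReal lam ^ (n + 1) = ⊤ ∧
    ∑' n : ℕ, ((n + 1 : ℕ) : ℝ≥0∞) * firstReturnPartitionFn φ a (n + 1) /
      ENNReal.ofReal lam ^ (n + 1) < ⊤

/-- The Ruelle operator `(L_φ F)(x) = ∑_{T y = x} exp (φ y) F(y)` on nonnegative functions. -/
def ruelleOp (φ : MarkovShift A → ℝ) (F : MarkovShift A → ℝ≥0∞) (x : MarkovShift A) : ℝ≥0∞ :=
  ∑' y : {y : MarkovShift A // shift y = x}, ENNReal.ofReal (Real.exp (φ y.1)) * F y.1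

/-- `m` is the Ruelle-Perron-Frobenius measure of `φ` for the eigenvalue `lam`: `dm = h dν`, where
`h` is a positive continuous function with `L_φ h = lam h`, and `ν` is a measure, finite on the
partition elements, with `L_φ^* ν = lam ν`. -/
def IsRPFMeasure [MeasurableSpace S] [TopologicalSpace S] (φ : MarkovShift A → ℝ) (lam : ℝ)
    (m : Measure (MarkovShift A)) : Prop :=
  ∃ (h : MarkovShift A → ℝ) (ν : Measure (MarkovShift A)),
    Continuous h ∧ (∀ x, 0 < h x) ∧
    (∀ x, ruelleOp φ (fun y => ENNReal.ofReal (h y)) x =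
      ENNReal.ofReal lam * ENNReal.ofReal (h x)) ∧
    (∀ a, ν (cyl A a) < ⊤) ∧
    (∀ F : MarkovShift A → ℝ≥0∞, Measurable F →
      ∫⁻ x, ruelleOp φ F x ∂ν = ENNReal.ofReal lam * ∫⁻ x, F x ∂ν) ∧
    m = ν.withDensity (fun x => ENNReal.ofReal (h x))

/-- The shift is transitive for `m`: for all partition elements `[a]`, `[b]` (of positive measure),
there is `n` with `[b] ⊆ T^n [a]` modulo a null set. -/
def IsTransitive [MeasurableSpace S] (m : Measure (MarkovShift A)) : Prop :=
  ∀ a b : S, m (cyl A a) ≠ 0 → m (cyl A b) ≠ 0 →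
    ∃ n : ℕ, m (cyl A b \ (shift^[n] '' cyl A a)) = 0

/-- `Df(Z)`: the best Lipschitz constant of `f` on a subset of `Z` of full measure, for the
distance `τ ^ s(x, y)`; it is `∞` if there is none. -/
def essLip [MeasurableSpace S] {G : Type*} [NormedAddCommGroup G] (τ : ℝ)
    (m : Measure (MarkovShift A)) (f : MarkovShift A → G) (Z : Set (MarkovShift A)) : ℝ≥0∞ :=
  sInf {c : ℝ≥0∞ | ∃ C : ℝ, 0 < C ∧ c = ENNReal.ofReal C ∧
    ∃ Ω ⊆ Z, m (Z \ Ω) = 0 ∧ ∀ x ∈ Ω, ∀ y ∈ Ω, dist (f x) (f y) ≤ C * sepDist τ x y}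

end MarkovShift

end

/-!
Write `m = h dν` and let `φₙ`, `fₙ` be the Birkhoff sums. For a point `y` with `yₙ = a`, the inverse
branch `x ↦ y₀ … y_{n-1} x` of `T ^ n` maps `[a]` onto the cylinder `cylAt n y` of length `n + 1`.
As `u (T ^ n z) = u z - fₙ z`, for almost all `x, x' ∈ [a]` with images `z, z'` under this branch,
`|u x - u x'| ≤ |u z - u z'| + |fₙ z - fₙ z'|`, and the last term is at most
`lipWeight τ C n y * d(x, x')`, where `lipWeight τ C n y = ∑_{k<n} τ ^ (n - k) * C (y_k)` and `C b`
bounds `Df([b])` (`dist_le_of_iterate_shift`). It remains to find branches along which this weight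
is bounded while `u` is almost constant on most of the cylinder.

*Bounded weight.* By invariance of `m`, the integral of `lipWeight τ C n` over `{xₙ = a}` increases
with `n` to `J a = meanLipWeight τ C m a`, and `∑ a, J a` is `∑ C b m([b])` times a geometric
series, hence finite. By Markov's inequality, with `M = 2 * J a / m([a]) + 1` the event
`{xₙ = a, lipWeight τ C n x ≤ M}` has measure at least `m([a]) / 2` for all `n`
(`half_measure_cyl_le`), so a set of positive measure of points `x` belongs to infinitely many of
these events (`le_measure_frequently`).

*Small oscillation of `u`.* Some ball of radius `ε` has a preimage under `u` that meets this set in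
a set `F` of positive measure (`exists_measure_inter_preimage_ball_ne_zero`), and by a density
argument `F` fills up, to any given proportion, a cylinder at one of the good times
(`exists_measure_cylAt_diff_le`). The measure `ν`, unlike `m`, has an explicit Jacobian `exp (-φₙ)`
along the branch, whose distortion is bounded by local Hölder continuity; therefore the branch maps
most of `[a]` into `F` (`exists_measure_branch_notMem_mul_le`).

Letting `ε → 0`, the Borel–Cantelli lemma gives `Du([a]) ≤ M` (`essLip_le_of_frequently`), and then
`∑ m([a]) * Du([a]) ≤ ∑ (2 * J a + m([a])) < ∞`.
-/

/-! ### Essential separability of measurable maps into locally compact groups -/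

/-- If all subsets of `Y` have a measurable preimage under a continuous map `e` with null fibers,
then the measure is zero. Otherwise some compact set of positive measure has an uncountable compact
image, all of whose subsets are Borel; but a Polish space has only continuum many Borel sets. -/
theorem measure_eq_zero_of_continuous_of_fiber {X Y : Type*}
    [TopologicalSpace X] [PolishSpace X] [MeasurableSpace X] [BorelSpace X]
    [TopologicalSpace Y] [PolishSpace Y] [MeasurableSpace Y] [BorelSpace Y]
    (μ : Measure X) [IsFiniteMeasure μ] {e : X → Y} (he : Continuous e)
    (hall : ∀ s : Set Y, MeasurableSet (e ⁻¹' s)) {E : Set X} (hE : MeasurableSet E)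
    (hfib : ∀ y, μ (E ∩ e ⁻¹' {y}) = 0) : μ E = 0 := by
  by_contra hμ
  obtain ⟨K, hKE, hK, hKμ⟩ :=
    hE.exists_lt_isCompact_of_ne_top (measure_ne_top μ E) (pos_iff_ne_zero.2 hμ)
  have hKm : MeasurableSet K := hK.isClosed.measurableSet
  have himg : MeasurableSet (e '' K) := (hK.image he).isClosed.measurableSet
  have : StandardBorelSpace K := hKm.standardBorel
  have : StandardBorelSpace (e '' K) := himg.standardBorel
  have hunc : ¬ Countable (e '' K) := by
    intro hc
    refine hKμ.ne' (measure_mono_null (t := ⋃ y ∈ e '' K, E ∩ e ⁻¹' {y}) ?_ ?_)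
    · intro x hx
      exact Set.mem_biUnion (Set.mem_image_of_mem e hx) ⟨hKE hx, rfl⟩
    · exact (measure_biUnion_null_iff hc).2 fun y _ => hfib y
  let r : K → e '' K := fun x => ⟨e x, Set.mem_image_of_mem e x.2⟩
  have hr : Measurable r := (he.measurable.comp measurable_subtype_coe).subtype_mk
  have hrs : Function.Surjective r := by
    rintro ⟨_, x, hx, rfl⟩
    exact ⟨⟨x, hx⟩, rfl⟩
  have hsub : ∀ s : Set (e '' K), MeasurableSet s := by
    intro s
    rw [← hr.measurableSet_preimage_iff_of_surjective hrs]
    have : r ⁻¹' s = Subtype.val ⁻¹' (e ⁻¹' (Subtype.val '' s)) := by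
      ext x
      simp [r]
      grind
    rw [this]
    exact measurable_subtype_coe (hall _)
  have hR : ¬ Countable ℝ := not_countable_iff.2 inferInstance
  let ψ : e '' K ≃ᵐ ℝ := PolishSpace.measurableEquivOfNotCountable hunc hR
  have hcard : Cardinal.mk {t : Set ℝ | MeasurableSet t} ≤ Cardinal.continuum := by
    obtain ⟨b, hb, -, hb2⟩ := TopologicalSpace.exists_countable_basis ℝ
    have := MeasurableSpace.cardinal_measurableSet_le_continuum (s := b)
      ((Cardinal.mk_le_aleph0_iff.2 hb).trans Cardinal.aleph0_le_continuum)
    rwa [← hb2.borel_eq_generateFrom, ← BorelSpace.measurable_eq] at this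
  have huniv : {t : Set ℝ | MeasurableSet t} = Set.univ := by
    refine Set.eq_univ_of_forall fun t => ?_
    have := hsub (ψ ⁻¹' t)
    exact (ψ.measurableSet_preimage).1 this
  rw [huniv, Cardinal.mk_univ, Cardinal.mk_set, Cardinal.mk_real] at hcard
  exact (Cardinal.cantor _).not_ge hcard

/-- A partition all of whose unions of pieces are measurable has a piece of positive measure, even
if it is uncountable: for a map `e` selecting a point in each piece, all preimages are measurable,
and `e` is continuous for a finer Polish topology. -/
theorem exists_measure_inter_fiber_ne_zero {X Q : Type*} [MeasurableSpace X] [StandardBorelSpace X]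
    (μ : Measure X) [IsFiniteMeasure μ] {g : X → Q} (hg : ∀ s : Set Q, MeasurableSet (g ⁻¹' s))
    {E : Set X} (hE : MeasurableSet E) (hμ : μ E ≠ 0) : ∃ q, μ (E ∩ g ⁻¹' {q}) ≠ 0 := by
  by_contra! hfib
  obtain ⟨x₀, -⟩ := nonempty_of_measure_ne_zero hμ
  have : Nonempty X := ⟨x₀⟩
  let up := upgradeStandardBorel X
  have hmeas : ‹MeasurableSpace X› = borel X := BorelSpace.measurable_eq
  have hP : PolishSpace X := inferInstance
  let e : X → X := fun x => Function.invFun g (g x)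
  have hge : ∀ x, g (e x) = g x := fun x => Function.invFun_eq ⟨x, rfl⟩
  have hall : ∀ s : Set X, MeasurableSet (e ⁻¹' s) := fun s => hg (Function.invFun g ⁻¹' s)
  obtain ⟨t', ht', hcont, hpol⟩ :=
    Measurable.exists_continuous (f := e) (fun s _ => hall s)
  have hb : @BorelSpace X t' _ := by
    exact @BorelSpace.mk X t' _ (hmeas.trans (@borel_eq_borel_of_le X t' _ hpol hP ht').symm)
  refine hμ (@measure_eq_zero_of_continuous_of_fiber X X t' hpol _ hb up.toTopologicalSpace _ _ _
    μ _ e hcont hall E hE fun y => ?_)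
  refine measure_mono_null ?_ (hfib (g y))
  rintro x ⟨hx, rfl⟩
  exact ⟨hx, (hge x).symm⟩

theorem exists_isOpen_isSeparable_addSubgroup (G : Type*) [NormedAddCommGroup G]
    [LocallyCompactSpace G] :
    ∃ H : AddSubgroup G, IsOpen (H : Set G) ∧ TopologicalSpace.IsSeparable (H : Set G) := by
  obtain ⟨K, hK, hK0⟩ := exists_compact_mem_nhds (0 : G)
  obtain ⟨c, hc, hKc⟩ := hK.isSeparable
  have hsep : TopologicalSpace.IsSeparable
      ((Submodule.span ℤ c).toAddSubgroup.topologicalClosure : Set G) := by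
    have : Countable c := hc
    have h2 : (Submodule.span ℤ c : Set G).Countable := by
      rw [← Subtype.range_coe (s := c), ← Finsupp.range_linearCombination ℤ]
      exact Set.countable_range (Finsupp.linearCombination ℤ (Subtype.val : c → G))
    exact h2.isSeparable.closure
  refine ⟨_, AddSubgroup.isOpen_of_mem_nhds _ (g := 0) (mem_of_superset hK0 ?_), hsep⟩
  exact hKc.trans (closure_mono Submodule.subset_span)

/-- No separability of `G` is needed: the cosets of an open separable subgroup form a partition of
`G`, of which one piece has a preimage of positive measure, and this piece is separable. -/
theorem exists_measure_inter_preimage_ball_ne_zero {X G : Type*} [MeasurableSpace X]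
    [StandardBorelSpace X] [NormedAddCommGroup G] [LocallyCompactSpace G] [MeasurableSpace G]
    [BorelSpace G] (μ : Measure X) [IsFiniteMeasure μ] {u : X → G} (hu : Measurable u)
    {E : Set X} (hE : MeasurableSet E) (hμ : μ E ≠ 0) {ε : ℝ} (hε : 0 < ε) :
    ∃ p, μ (E ∩ u ⁻¹' Metric.ball p ε) ≠ 0 := by
  obtain ⟨H, hHo, hHs⟩ := exists_isOpen_isSeparable_addSubgroup G
  have hg : ∀ s : Set (G ⧸ H), MeasurableSet ((fun x => (u x : G ⧸ H)) ⁻¹' s) := by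
    intro s
    have : DiscreteTopology (G ⧸ H) := QuotientAddGroup.discreteTopology hHo
    have h1 : IsOpen ((fun y : G => (y : G ⧸ H)) ⁻¹' s) :=
      (isOpen_discrete s).preimage continuous_quot_mk
    exact hu h1.measurableSet
  obtain ⟨q, hq⟩ := exists_measure_inter_fiber_ne_zero μ hg hE hμ
  obtain ⟨p₀, rfl⟩ := QuotientAddGroup.mk_surjective q
  obtain ⟨c, hc, hHc⟩ := hHs
  by_contra! hnull
  refine hq (measure_mono_null (t := ⋃ p ∈ c, E ∩ u ⁻¹' Metric.ball (p₀ + p) ε) ?_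
    ((measure_biUnion_null_iff hc).2 fun p _ => hnull _))
  rintro x ⟨hx, hxq⟩
  have h1 : -p₀ + u x ∈ H := QuotientAddGroup.eq.1 (Set.mem_singleton_iff.1 hxq).symm
  obtain ⟨p, hp, hd⟩ := Metric.mem_closure_iff.1 (hHc h1) ε hε
  refine Set.mem_biUnion hp ⟨hx, ?_⟩
  rw [Set.mem_preimage, Metric.mem_ball]
  rw [dist_eq_norm] at hd ⊢
  convert hd using 2
  abel

/-! ### Cylinders, inverse branches and distortion -/

namespace MarkovShift

section

variable {S : Type*} {A : S → S → Prop}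

@[simp] theorem shift_apply (x : MarkovShift A) (i : ℕ) : (shift x).1 i = x.1 (i + 1) := rfl

@[simp] theorem iterate_shift_apply (x : MarkovShift A) (n i : ℕ) :
    (shift^[n] x).1 i = x.1 (i + n) := by
  induction n generalizing x with
  | zero => rfl
  | succ n ih => rw [Function.iterate_succ_apply, ih, shift_apply, add_assoc]

/-- The cylinder around `y` on which the coordinates `0, …, n` (so `n + 1` of them) are fixed. -/
def cylAt (n : ℕ) (y : MarkovShift A) : Set (MarkovShift A) :=
  {x | ∀ i ≤ n, x.1 i = y.1 i}

open Classical in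
/-- The inverse branch of `T ^ n` along the word `y₀ … y_{n-1}`: it sends `x` to
`y₀ … y_{n-1} x₀ x₁ …` for `x ∈ [yₙ]`. Outside `[yₙ]` its value is the irrelevant point `y`. -/
noncomputable def branch (n : ℕ) (y x : MarkovShift A) : MarkovShift A :=
  if h : x.1 0 = y.1 n then
    ⟨fun i => if i < n then y.1 i else x.1 (i - n), fun i => by
      rcases lt_trichotomy (i + 1) n with h1 | h1 | h1
      · simpa [h1, (Nat.lt_succ_self i).trans h1] using y.2 i
      · have h2 : i < n := by omega
        have h3 := y.2 i
        rw [h1, ← h] at h3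
        simpa [h1, h2] using h3
      · have h2 : ¬ i < n := by omega
        have h3 : ¬ i + 1 < n := by omega
        have h4 : i + 1 - n = i - n + 1 := by omega
        simpa [h2, h3, h4] using x.2 (i - n)⟩
  else y

open Classical in
theorem branch_apply {n : ℕ} {y x : MarkovShift A} (h : x.1 0 = y.1 n) (i : ℕ) :
    (branch n y x).1 i = if i < n then y.1 i else x.1 (i - n) := by
  simp [branch, h]

theorem branch_mem_cylAt {n : ℕ} {y x : MarkovShift A} (h : x.1 0 = y.1 n) :
    branch n y x ∈ cylAt n y := by
  intro i hi
  rw [branch_apply h]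
  split_ifs with h1
  · rfl
  · obtain rfl : i = n := by omega
    simpa using h

theorem iterate_shift_branch {n : ℕ} {y x : MarkovShift A} (h : x.1 0 = y.1 n) :
    shift^[n] (branch n y x) = x := by
  ext i
  simp [branch_apply h]

theorem branch_iterate_shift {n : ℕ} {y z : MarkovShift A} (hz : z ∈ cylAt n y) :
    branch n y (shift^[n] z) = z := by
  have h : (shift^[n] z).1 0 = y.1 n := by simpa using hz n le_rfl
  ext i
  rw [branch_apply h]
  split_ifs with h1
  · exact (hz i h1.le).symm
  · simp [Nat.sub_add_cancel (not_lt.1 h1)]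

theorem sepDist_nonneg {τ : ℝ} (hτ : 0 ≤ τ) (x y : MarkovShift A) : 0 ≤ sepDist τ x y := by
  unfold sepDist
  split_ifs <;> positivity

theorem cylAt_eq_iInter (n : ℕ) (y : MarkovShift A) :
    cylAt n y = ⋂ i ∈ Set.Iic n, (fun x : MarkovShift A => x.1 i) ⁻¹' {y.1 i} := by
  ext x
  simp [cylAt]

/-- The inverse branches of `T ^ n` contract `sepDist τ` by the factor `τ ^ n`. -/
theorem sepDist_eq_pow_mul {τ : ℝ} {n : ℕ} {x y : MarkovShift A} (h : ∀ i < n, x.1 i = y.1 i) :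
    sepDist τ x y = τ ^ n * sepDist τ (shift^[n] x) (shift^[n] y) := by
  unfold sepDist
  by_cases hxy : x = y
  · simp [hxy]
  have hne : shift^[n] x ≠ shift^[n] y := by
    intro hs
    refine hxy (Subtype.ext (funext fun i => ?_))
    rcases lt_or_ge i n with hi | hi
    · exact h i hi
    · have := congrArg (fun z => z.1 (i - n)) hs
      simpa [Nat.sub_add_cancel hi] using this
  have hex : {i | (shift^[n] x).1 i ≠ (shift^[n] y).1 i}.Nonempty := by
    by_contra hemp
    rw [Set.not_nonempty_iff_eq_empty, Set.eq_empty_iff_forall_notMem] at hemp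
    exact hne (Subtype.ext (funext fun i => not_not.1 (hemp i)))
  rw [if_neg hxy, if_neg hne, ← pow_add]
  congr 1
  apply le_antisymm
  · have := Nat.sInf_mem hex
    apply Nat.sInf_le
    simpa [add_comm] using this
  · apply le_csInf
    · obtain ⟨i, hi⟩ := hex
      exact ⟨i + n, by simpa using hi⟩
    · intro i hi
      have hin : n ≤ i := by
        by_contra hlt
        exact hi (h i (not_le.1 hlt))
      have : sInf {i | (shift^[n] x).1 i ≠ (shift^[n] y).1 i} ≤ i - n := by
        apply Nat.sInf_le
        simpa [Nat.sub_add_cancel hin] using hi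
      omega

/-- Bounded distortion of the Birkhoff sums: as points of `cylAt n y` have `n + 1` coordinates in
common, the first `n` of their iterates still have at least two, so that no hypothesis on the
oscillation of `φ` on cylinders of length one is needed. -/
theorem IsLocallyHolder.exists_abs_birkhoffSum_sub_le {φ : MarkovShift A → ℝ}
    (hφ : IsLocallyHolder φ) :
    ∃ D : ℝ, ∀ (n : ℕ) (y z : MarkovShift A), z ∈ cylAt n y →
      |birkhoffSum shift φ n z - birkhoffSum shift φ n y| ≤ D := by
  obtain ⟨K, θ, hθ0, hθ1, hK⟩ := hφ
  refine ⟨|K| * (1 - θ)⁻¹, fun n y z hz => ?_⟩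
  calc |birkhoffSum shift φ n z - birkhoffSum shift φ n y|
      = |∑ k ∈ Finset.range n, (φ (shift^[k] z) - φ (shift^[k] y))| := by
        rw [birkhoffSum, birkhoffSum, Finset.sum_sub_distrib]
    _ ≤ ∑ k ∈ Finset.range n, |φ (shift^[k] z) - φ (shift^[k] y)| :=
        Finset.abs_sum_le_sum_abs _ _
    _ ≤ ∑ k ∈ Finset.range n, |K| * θ ^ (n - 1 - k) := by
        refine Finset.sum_le_sum fun k hk => ?_
        have hk' : k < n := Finset.mem_range.1 hk
        refine (hK (n + 1 - k) (by omega) _ _ fun i hi => ?_).trans ?_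
        · simpa using hz (i + k) (by omega)
        · refine mul_le_mul (le_abs_self K) ?_ (by positivity) (abs_nonneg K)
          exact pow_le_pow_of_le_one hθ0.le hθ1.le (by omega)
    _ = |K| * ∑ k ∈ Finset.range n, θ ^ k := by
        rw [← Finset.mul_sum, Finset.sum_range_reflect (fun k => θ ^ k)]
    _ ≤ |K| * (1 - θ)⁻¹ := by
        gcongr
        rw [← tsum_geometric_of_lt_one hθ0.le hθ1]
        exact (summable_geometric_of_lt_one hθ0.le hθ1).sum_le_tsum _ fun i _ => by positivity

theorem measurable_coord [MeasurableSpace S] (i : ℕ) : Measurable fun x : MarkovShift A => x.1 i :=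
  (measurable_pi_apply i).comp measurable_subtype_coe

theorem continuous_coord [TopologicalSpace S] (i : ℕ) : Continuous fun x : MarkovShift A => x.1 i :=
  (continuous_apply i).comp continuous_subtype_val

theorem exists_cylAt_subset [TopologicalSpace S] {U : Set (MarkovShift A)}
    (hU : IsOpen U) {y : MarkovShift A}
    (hy : y ∈ U) : ∃ N, ∀ n ≥ N, cylAt n y ⊆ U := by
  obtain ⟨V, hV, rfl⟩ := isOpen_induced_iff.1 hU
  obtain ⟨I, t, ht, hsub⟩ := isOpen_pi_iff.1 hV y.1 hy
  refine ⟨I.sup id, fun n hn x hx => hsub fun i hi => ?_⟩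
  rw [hx i ((Finset.le_sup (f := id) hi).trans hn)]
  exact (ht i hi).2

theorem measurable_shift [MeasurableSpace S] :
    Measurable (shift : MarkovShift A → MarkovShift A) :=
  (measurable_pi_lambda _ fun i => measurable_coord (i + 1)).subtype_mk

theorem isOpen_cylAt [TopologicalSpace S] [DiscreteTopology S] (n : ℕ)
    (y : MarkovShift A) : IsOpen (cylAt n y) := by
  rw [cylAt_eq_iInter]
  exact (Set.finite_Iic n).isOpen_biInter fun i _ =>
    (isOpen_discrete _).preimage (continuous_coord i)

theorem IsLocallyHolder.continuous [TopologicalSpace S] [DiscreteTopology S]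
    {φ : MarkovShift A → ℝ} (hφ : IsLocallyHolder φ) :
    Continuous φ := by
  obtain ⟨K, θ, hθ0, hθ1, hK⟩ := hφ
  rw [continuous_iff_continuousAt]
  intro x
  rw [ContinuousAt, Metric.tendsto_nhds]
  intro ε hε
  have h1 : Tendsto (fun n : ℕ => K * θ ^ n) atTop (nhds 0) := by
    simpa using (tendsto_pow_atTop_nhds_zero_of_lt_one hθ0.le hθ1).const_mul K
  obtain ⟨n, hn, hn2⟩ := ((h1.eventually_lt_const hε).and (eventually_ge_atTop 2)).exists
  filter_upwards [(isOpen_cylAt n x).mem_nhds fun i _ => rfl] with y hy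
  exact (hK n hn2 y x fun i hi => hy i hi.le).trans_lt hn

end

section

variable {S : Type*} [MeasurableSpace S] [DiscreteMeasurableSpace S] {A : S → S → Prop}

theorem measurableSet_cyl (a : S) : MeasurableSet (cyl A a) :=
  measurable_coord 0 (MeasurableSet.of_discrete (s := {a}))

theorem measurableSet_cylAt (n : ℕ) (y : MarkovShift A) : MeasurableSet (cylAt n y) := by
  rw [cylAt_eq_iInter]
  exact MeasurableSet.biInter (Set.to_countable _) fun i _ =>
    measurable_coord i MeasurableSet.of_discrete

theorem measurable_branch (n : ℕ) (y : MarkovShift A) : Measurable (branch n y) := by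
  classical
  refine Measurable.subtype_mk (f := fun x => (branch n y x).1) (h := fun x => (branch n y x).2)
    (measurable_pi_lambda _ fun i => ?_)
  have : (fun x : MarkovShift A => (branch n y x).1 i) = fun x =>
      if x.1 0 = y.1 n then (if i < n then y.1 i else x.1 (i - n)) else y.1 i := by
    ext x
    split_ifs with h h1
    · rw [branch_apply h, if_pos h1]
    · rw [branch_apply h, if_neg h1]
    · simp [branch, h]
  rw [this]
  refine Measurable.ite (measurableSet_cyl (y.1 n)) ?_ measurable_const
  split_ifs
  · exact measurable_const
  · exact measurable_coord _

theorem standardBorelSpace_markovShift [Countable S] :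
    StandardBorelSpace (MarkovShift A) := by
  refine MeasurableSet.standardBorel (s := {x : ℕ → S | ∀ n, A (x n) (x (n + 1))}) ?_
  rw [Set.ofPred_forall]
  refine MeasurableSet.iInter fun n => ?_
  have h : Measurable fun x : ℕ → S => (x n, x (n + 1)) :=
    (measurable_pi_apply n).prodMk (measurable_pi_apply (n + 1))
  exact h (MeasurableSet.of_discrete (s := {p : S × S | A p.1 p.2}))

end
end MarkovShift

/-! ### The eigenmeasure of the dual Ruelle operator -/

namespace MarkovShift

section

variable {S : Type*} {A : S → S → Prop}

/-- One step of the change of variables: among the preimages of a point of `[y₁]`, exactly one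
belongs to the cylinder of length two around `y`, and the weights cancel there. -/
theorem ruelleOp_indicator_cylAt_one (φ : MarkovShift A → ℝ) (y : MarkovShift A)
    (H : MarkovShift A → ℝ≥0∞) (x : MarkovShift A) :
    ruelleOp φ ((cylAt 1 y).indicator fun z => ENNReal.ofReal (Real.exp (-φ z)) * H (shift z)) x =
      (cyl A (y.1 1)).indicator H x := by
  unfold ruelleOp
  by_cases hx : x.1 0 = y.1 1
  · have hs : shift (branch 1 y x) = x := iterate_shift_branch hx
    rw [tsum_eq_single ⟨branch 1 y x, hs⟩, Set.indicator_of_mem (branch_mem_cylAt hx),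
      Set.indicator_of_mem (show x ∈ cyl A (y.1 1) from hx), hs, ← mul_assoc,
      ← ENNReal.ofReal_mul (Real.exp_pos _).le, ← Real.exp_add]
    · simp
    · rintro ⟨z, rfl⟩ hz
      rw [Set.indicator_of_notMem, mul_zero]
      intro hzc
      exact hz (Subtype.ext (branch_iterate_shift hzc).symm)
  · rw [Set.indicator_of_notMem (show x ∉ cyl A (y.1 1) from hx), ENNReal.tsum_eq_zero]
    rintro ⟨z, rfl⟩
    rw [Set.indicator_of_notMem, mul_zero]
    exact fun hz => hx (hz 1 le_rfl)

theorem mem_cylAt_succ {n : ℕ} {x y : MarkovShift A} :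
    x ∈ cylAt (n + 1) y ↔ x ∈ cylAt 1 y ∧ shift x ∈ cylAt n (shift y) := by
  constructor
  · intro h
    exact ⟨fun i hi => h i (by omega), fun i hi => h (i + 1) (by omega)⟩
  · rintro ⟨h1, h2⟩ i hi
    rcases i with _ | i
    · exact h1 0 zero_le_one
    · exact h2 i (by omega)

theorem measurable_birkhoffSum [MeasurableSpace S] {φ : MarkovShift A → ℝ}
    (hφ : Measurable φ) (n : ℕ) :
    Measurable (birkhoffSum shift φ n) := by
  unfold birkhoffSum
  exact Finset.measurable_fun_sum _ fun k _ => hφ.comp (measurable_shift.iterate k)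

end

section

variable {S : Type*} [MeasurableSpace S] [DiscreteMeasurableSpace S] {A : S → S → Prop}

/-- Change of variables along an inverse branch of `T ^ n`: for an eigenmeasure of the dual Ruelle
operator, `T ^ n` maps the cylinder of length `n + 1` around `y` bijectively onto `[yₙ]`, with
Jacobian `lam ^ n * exp (-φₙ)`. -/
theorem setLIntegral_cyl_eq {φ : MarkovShift A → ℝ} (hφ : Measurable φ) {lam : ℝ}
    {ν : Measure (MarkovShift A)}
    (hν : ∀ F : MarkovShift A → ℝ≥0∞, Measurable F →
      ∫⁻ x, ruelleOp φ F x ∂ν = ENNReal.ofReal lam * ∫⁻ x, F x ∂ν)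
    (n : ℕ) (y : MarkovShift A) {G : MarkovShift A → ℝ≥0∞} (hG : Measurable G) :
    ∫⁻ x in cyl A (y.1 n), G x ∂ν = ENNReal.ofReal lam ^ n *
      ∫⁻ x in cylAt n y,
        ENNReal.ofReal (Real.exp (-birkhoffSum shift φ n x)) * G (shift^[n] x) ∂ν := by
  induction n generalizing y with
  | zero =>
    have : cylAt 0 y = cyl A (y.1 0) := by
      ext x
      simp [cylAt, cyl]
    simp [this]
  | succ n ih =>
    have hW : Measurable fun x : MarkovShift A =>
        ENNReal.ofReal (Real.exp (-birkhoffSum shift φ n x)) * G (shift^[n] x) :=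
      (measurable_birkhoffSum hφ n).neg.exp.ennreal_ofReal.mul
        (hG.comp (measurable_shift.iterate n))
    set H := (cylAt n (shift y)).indicator fun x : MarkovShift A =>
        ENNReal.ofReal (Real.exp (-birkhoffSum shift φ n x)) * G (shift^[n] x) with hH
    have hHm : Measurable H := hW.indicator (measurableSet_cylAt _ _)
    have h1 := ih (shift y)
    rw [shift_apply] at h1
    rw [h1, ← lintegral_indicator (measurableSet_cylAt _ _), ← hH]
    have h2 : (cyl A (y.1 1)).indicator H = H := by
      refine Set.indicator_eq_self.2 fun x hx => ?_
      exact Set.mem_of_indicator_ne_zero hx 0 n.zero_le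
    have h3 := hν _ (((hφ.neg.exp.ennreal_ofReal).mul (hHm.comp measurable_shift)).indicator
      (measurableSet_cylAt 1 y))
    have h4 : ∀ x, ruelleOp φ ((cylAt 1 y).indicator fun z =>
        ENNReal.ofReal (Real.exp (-φ z)) * H (shift z)) x = H x := fun x => by
      rw [ruelleOp_indicator_cylAt_one, h2]
    have h5 : ∫⁻ x, H x ∂ν = ENNReal.ofReal lam * ∫⁻ x, (cylAt 1 y).indicator (fun z =>
        ENNReal.ofReal (Real.exp (-φ z)) * H (shift z)) x ∂ν :=
      (lintegral_congr fun x => (h4 x).symm).trans h3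
    rw [h5, ← mul_assoc, ← pow_succ, ← lintegral_indicator (measurableSet_cylAt _ _)]
    congr 1
    refine lintegral_congr fun x => ?_
    by_cases hx : x ∈ cylAt (n + 1) y
    · obtain ⟨hx1, hx2⟩ := mem_cylAt_succ.1 hx
      rw [Set.indicator_of_mem hx, Set.indicator_of_mem hx1, hH, Set.indicator_of_mem hx2,
        ← mul_assoc, ← ENNReal.ofReal_mul (Real.exp_pos _).le, ← Real.exp_add,
        birkhoffSum_succ', neg_add, Function.iterate_succ_apply]
    · rw [Set.indicator_of_notMem hx]
      by_cases hx1 : x ∈ cylAt 1 y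
      · have hx2 : shift x ∉ cylAt n (shift y) := fun h => hx (mem_cylAt_succ.2 ⟨hx1, h⟩)
        rw [Set.indicator_of_mem hx1, hH, Set.indicator_of_notMem hx2, mul_zero]
      · rw [Set.indicator_of_notMem hx1]

/-- Bounded distortion of the eigenmeasure: up to a factor independent of `n` and `y`, the
proportion of `[yₙ]` that the inverse branch along `y₀ … y_{n-1}` sends outside `E` is at most the
proportion of the complement of `E` in the cylinder around `y`. -/
theorem exists_measure_branch_notMem_mul_le [Countable S] [TopologicalSpace S]
    [DiscreteTopology S] {φ : MarkovShift A → ℝ} (hφ : IsLocallyHolder φ) {lam : ℝ}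
    {ν : Measure (MarkovShift A)}
    (hν : ∀ F : MarkovShift A → ℝ≥0∞, Measurable F →
      ∫⁻ x, ruelleOp φ F x ∂ν = ENNReal.ofReal lam * ∫⁻ x, F x ∂ν) :
    ∃ D : ℝ≥0∞, D ≠ ⊤ ∧ ∀ (n : ℕ) (y : MarkovShift A) (E : Set (MarkovShift A)),
      MeasurableSet E →
      ν {x ∈ cyl A (y.1 n) | branch n y x ∉ E} * ν (cylAt n y) ≤
        D * ν (cyl A (y.1 n)) * ν (cylAt n y \ E) := by
  obtain ⟨D, hD⟩ := hφ.exists_abs_birkhoffSum_sub_le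
  have hφm := hφ.continuous.measurable
  set d := ENNReal.ofReal (Real.exp D)
  refine ⟨d * d, ENNReal.mul_ne_top ENNReal.ofReal_ne_top ENNReal.ofReal_ne_top,
    fun n y E hE => ?_⟩
  set W : MarkovShift A → ℝ≥0∞ := fun x => ENNReal.ofReal (Real.exp (-birkhoffSum shift φ n x))
  have hW1 : ∀ z ∈ cylAt n y, W z ≤ d * W y := by
    intro z hz
    simp only [W, d]
    rw [← ENNReal.ofReal_mul (Real.exp_pos _).le, ← Real.exp_add]
    refine ENNReal.ofReal_le_ofReal (Real.exp_le_exp.2 ?_)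
    have := neg_le_of_abs_le (hD n y z hz)
    linarith
  have hW2 : ∀ z ∈ cylAt n y, W y ≤ d * W z := by
    intro z hz
    simp only [W, d]
    rw [← ENNReal.ofReal_mul (Real.exp_pos _).le, ← Real.exp_add]
    refine ENNReal.ofReal_le_ofReal (Real.exp_le_exp.2 ?_)
    have := le_of_abs_le (hD n y z hz)
    linarith
  set B := {x ∈ cyl A (y.1 n) | branch n y x ∉ E}
  have hB : MeasurableSet B :=
    (measurableSet_cyl _).inter (measurable_branch n y hE.compl)
  have hC := measurableSet_cylAt n y
  have hWm : Measurable W := (measurable_birkhoffSum hφm n).neg.exp.ennreal_ofReal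
  have h1 : ν B ≤ ENNReal.ofReal lam ^ n * (d * W y * ν (cylAt n y \ E)) := by
    have h := setLIntegral_cyl_eq hφm hν n y (G := B.indicator 1) (measurable_one.indicator hB)
    rw [lintegral_indicator_one hB, Measure.restrict_apply hB,
      Set.inter_eq_left.2 (fun x hx => hx.1)] at h
    rw [h]
    gcongr
    rw [← setLIntegral_const, ← lintegral_indicator hC, ← lintegral_indicator (hC.diff hE)]
    refine lintegral_mono fun z => ?_
    by_cases hz : z ∈ cylAt n y
    · rw [Set.indicator_of_mem hz]
      by_cases hzE : z ∈ E
      · have : shift^[n] z ∉ B := fun hb => hb.2 (by rwa [branch_iterate_shift hz])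
        simp [Set.indicator_of_notMem this]
      · rw [Set.indicator_of_mem (show z ∈ cylAt n y \ E from ⟨hz, hzE⟩)]
        refine (mul_le_of_le_one_right' ?_).trans (hW1 z hz)
        exact Set.indicator_le_self' (fun _ _ => zero_le) _ |>.trans le_rfl
    · simp [Set.indicator_of_notMem hz]
  have h2 : ENNReal.ofReal lam ^ n * (W y * ν (cylAt n y)) ≤ d * ν (cyl A (y.1 n)) := by
    have h := setLIntegral_cyl_eq hφm hν n y (G := 1) measurable_one
    simp only [Pi.one_apply, mul_one, lintegral_one, Measure.restrict_apply_univ] at h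
    rw [h, mul_left_comm d]
    refine mul_le_mul' le_rfl ?_
    rw [← setLIntegral_const, ← lintegral_const_mul _ hWm]
    exact setLIntegral_mono (hWm.const_mul _) hW2
  calc ν B * ν (cylAt n y)
      ≤ ENNReal.ofReal lam ^ n * (d * W y * ν (cylAt n y \ E)) * ν (cylAt n y) := by gcongr
    _ = d * (ENNReal.ofReal lam ^ n * (W y * ν (cylAt n y))) * ν (cylAt n y \ E) := by ring
    _ ≤ d * (d * ν (cyl A (y.1 n))) * ν (cylAt n y \ E) := by gcongr
    _ = d * d * ν (cyl A (y.1 n)) * ν (cylAt n y \ E) := by ring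

end
end MarkovShift

/-! ### Density points along cylinders -/

namespace MarkovShift

section

variable {S : Type*} {A : S → S → Prop}

theorem mem_cylAt_self (n : ℕ) (y : MarkovShift A) : y ∈ cylAt n y := fun _ _ => rfl

theorem cylAt_eq_of_mem {n k : ℕ} {y z : MarkovShift A} (hz : z ∈ cylAt n y) (hk : k ≤ n) :
    cylAt k z = cylAt k y := by
  ext x
  exact forall₂_congr fun i hi => by rw [hz i (hi.trans hk)]

theorem cylAt_subset_cyl (n : ℕ) (y : MarkovShift A) : cylAt n y ⊆ cyl A (y.1 0) :=
  fun _ hx => hx 0 n.zero_le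

/-- The word of the first `n + 1` coordinates. -/
def word (n : ℕ) (x : MarkovShift A) : Fin (n + 1) → S := fun i => x.1 i

theorem word_eq_word_iff {n : ℕ} {x y : MarkovShift A} : word n x = word n y ↔ x ∈ cylAt n y :=
  ⟨fun h i hi => congrFun h ⟨i, Nat.lt_succ_of_le hi⟩,
    fun h => funext fun i => h i (Nat.le_of_lt_succ i.2)⟩

theorem preimage_image_word {n : ℕ} {V : Set (MarkovShift A)}
    (hV : ∀ y ∈ V, cylAt n y ⊆ V) : word n ⁻¹' (word n '' V) = V := by
  refine subset_antisymm ?_ (Set.subset_preimage_image _ _)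
  rintro x ⟨y, hy, hyx⟩
  exact hV y hy (word_eq_word_iff.1 hyx.symm)

theorem measurable_word [MeasurableSpace S] (n : ℕ) :
    Measurable (word n : MarkovShift A → Fin (n + 1) → S) :=
  measurable_pi_lambda _ fun i => measurable_coord i

end

section

variable {S : Type*} [Countable S] [MeasurableSpace S] [DiscreteMeasurableSpace S]
  {A : S → S → Prop}

theorem measurableSet_of_cylAt_subset {n : ℕ} {V : Set (MarkovShift A)}
    (hV : ∀ y ∈ V, cylAt n y ⊆ V) : MeasurableSet V := by
  rw [← preimage_image_word hV]
  exact measurable_word n (Set.to_countable _).measurableSet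

/-- An inequality between measures can be checked on the cylinders of a given length that make up
the set in question. -/
theorem measure_le_measure_of_cylAt {μ₁ μ₂ : Measure (MarkovShift A)} {n : ℕ}
    {V : Set (MarkovShift A)} (hV : ∀ y ∈ V, cylAt n y ⊆ V)
    (h : ∀ y ∈ V, μ₁ (cylAt n y) ≤ μ₂ (cylAt n y)) : μ₁ V ≤ μ₂ V := by
  have hfib : ∀ y : MarkovShift A, word n ⁻¹' {word n y} = cylAt n y := fun y => by
    ext x
    exact word_eq_word_iff
  have key : ∀ μ : Measure (MarkovShift A), μ V =
      ∑' w, (word n '' V).indicator (fun w => μ (word n ⁻¹' {w})) w := fun μ => by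
    have h1 := (μ.map (word n)).tsum_indicator_apply_singleton (word n '' V)
      (Set.to_countable _).measurableSet
    rw [Measure.map_apply (measurable_word n) (Set.to_countable _).measurableSet,
      preimage_image_word hV] at h1
    rw [← h1]
    refine tsum_congr fun w => ?_
    congr 1
    ext w
    rw [Measure.map_apply (measurable_word n) (measurableSet_singleton w)]
  rw [key μ₁, key μ₂]
  refine ENNReal.tsum_le_tsum fun w => Set.indicator_le_indicator' ?_
  rintro ⟨y, hy, rfl⟩
  rw [hfib]
  exact h y hy

/-- A density point argument: a set `F` of positive measure, all of whose points satisfy `P n` for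
infinitely many `n`, fills up a cylinder at some `n` for which `P n` holds, up to a proportion `δ`.
Otherwise `F` could be covered within a set `U` of almost the same measure by disjoint cylinders,
those at the first time `n` at which `P n` holds and the cylinder is contained in `U`. -/
theorem exists_measure_cylAt_diff_le [TopologicalSpace S] [DiscreteTopology S]
    {μ : Measure (MarkovShift A)} [IsFiniteMeasure μ] {P : ℕ → MarkovShift A → Prop}
    (hP : ∀ n y z, z ∈ cylAt n y → P n y → P n z) {F : Set (MarkovShift A)} (hF : MeasurableSet F)
    (hFμ : μ F ≠ 0) (hFP : ∀ x ∈ F, ∃ᶠ n in atTop, P n x) {δ : ℝ≥0∞} (hδ : δ ≠ 0) :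
    ∃ n, ∃ y ∈ F, P n y ∧ μ (cylAt n y) ≠ 0 ∧ μ (cylAt n y \ F) ≤ δ * μ (cylAt n y) := by
  by_contra! hcon
  have : TopologicalSpace.PseudoMetrizableSpace (MarkovShift A) :=
    Topology.IsInducing.subtypeVal.pseudoMetrizableSpace
  obtain ⟨U, hFU, hU, -, hUF⟩ :=
    hF.exists_isOpen_sdiff_lt (measure_ne_top μ F) (mul_ne_zero hδ hFμ)
  set R : ℕ → MarkovShift A → Prop := fun n x => P n x ∧ cylAt n x ⊆ U
  have hR : ∀ n y z, z ∈ cylAt n y → R n y → R n z := fun n y z hz hy =>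
    ⟨hP n y z hz hy.1, (cylAt_eq_of_mem hz le_rfl).trans_subset hy.2⟩
  set V : ℕ → Set (MarkovShift A) := fun n => {x | R n x ∧ ∀ k < n, ¬ R k x}
  have hV : ∀ n, ∀ y ∈ V n, cylAt n y ⊆ V n := by
    refine fun n y hy z hz => ⟨hR n y z hz hy.1, fun k hk hRz => hy.2 k hk (hR k z y ?_ hRz)⟩
    rw [cylAt_eq_of_mem hz hk.le]
    exact mem_cylAt_self k y
  have hVm : ∀ n, MeasurableSet (V n) := fun n => measurableSet_of_cylAt_subset (hV n)
  have hdisj : Pairwise (Function.onFun Disjoint V) := by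
    refine fun i j hij => Set.disjoint_left.2 fun x hi hj => ?_
    rcases lt_or_gt_of_ne hij with h | h
    · exact hj.2 i h hi.1
    · exact hi.2 j h hj.1
  have hFV : F ⊆ ⋃ n, V n := by
    classical
    intro x hx
    obtain ⟨N, hN⟩ := exists_cylAt_subset hU (hFU hx)
    have hex : ∃ n, R n x := by
      obtain ⟨n, hn, hPn⟩ := frequently_atTop.1 (hFP x hx) N
      exact ⟨n, hPn, hN n hn⟩
    exact Set.mem_iUnion.2 ⟨Nat.find hex, Nat.find_spec hex, fun k hk => Nat.find_min hex hk⟩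
  have hVU : ⋃ n, V n ⊆ U := Set.iUnion_subset fun n x hx => hx.1.2 (mem_cylAt_self n x)
  have hle : ∀ n, δ * μ (V n ∩ F) ≤ μ (V n \ F) := by
    intro n
    have := measure_le_measure_of_cylAt (μ₁ := δ • μ.restrict F) (μ₂ := μ.restrict Fᶜ) (hV n)
      fun y hy => by
        have hc := measurableSet_cylAt n y
        rw [Measure.smul_apply, Measure.restrict_apply hc, Measure.restrict_apply hc, smul_eq_mul,
          ← Set.sdiff_eq]
        rcases Set.eq_empty_or_nonempty (cylAt n y ∩ F) with he | ⟨z, hz, hzF⟩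
        · simp [he]
        · rw [← cylAt_eq_of_mem hz le_rfl]
          refine le_trans (mul_le_mul' le_rfl (measure_mono Set.inter_subset_left)) ?_
          by_cases h0 : μ (cylAt n z) = 0
          · simp [h0]
          · exact (hcon n z hzF (hP n y z hz hy.1.1) h0).le
    rwa [Measure.smul_apply, Measure.restrict_apply (hVm n), Measure.restrict_apply (hVm n),
      smul_eq_mul, ← Set.sdiff_eq] at this
  refine absurd hUF (not_lt.2 ?_)
  calc δ * μ F = δ * μ (⋃ n, V n ∩ F) := by
        rw [← Set.iUnion_inter, Set.inter_eq_right.2 hFV]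
    _ = ∑' n, δ * μ (V n ∩ F) := by
        rw [measure_iUnion (fun i j hij => (hdisj hij).mono Set.inter_subset_left
          Set.inter_subset_left) fun n => (hVm n).inter hF, ENNReal.tsum_mul_left]
    _ ≤ ∑' n, μ (V n \ F) := ENNReal.tsum_le_tsum hle
    _ = μ (⋃ n, V n \ F) := by
        rw [measure_iUnion (fun i j hij => (hdisj hij).mono Set.sdiff_subset
          Set.sdiff_subset) fun n => (hVm n).diff hF]
    _ ≤ μ (U \ F) := by
        gcongr
        exact Set.iUnion_subset fun n => Set.sdiff_subset_sdiff_left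
          ((Set.subset_iUnion V n).trans hVU)

/-- The previous density statement for a measure that is only finite on the sets `[a]`. -/
theorem exists_measure_cylAt_diff_le_of_cyl [TopologicalSpace S] [DiscreteTopology S]
    {ν : Measure (MarkovShift A)} (hν : ∀ a, ν (cyl A a) < ⊤) {P : ℕ → MarkovShift A → Prop}
    (hP : ∀ n y z, z ∈ cylAt n y → P n y → P n z) {F : Set (MarkovShift A)} (hF : MeasurableSet F)
    (hFν : ν F ≠ 0) (hFP : ∀ x ∈ F, ∃ᶠ n in atTop, P n x) {δ : ℝ≥0∞} (hδ : δ ≠ 0) :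
    ∃ n, ∃ y ∈ F, P n y ∧ ν (cylAt n y) ≠ 0 ∧ ν (cylAt n y \ F) ≤ δ * ν (cylAt n y) := by
  obtain ⟨b, hb⟩ : ∃ b, ν (F ∩ cyl A b) ≠ 0 := by
    by_contra! h
    refine hFν (measure_mono_null (t := ⋃ b, F ∩ cyl A b) (fun x hx => ?_)
      (measure_iUnion_null h))
    exact Set.mem_iUnion.2 ⟨x.1 0, hx, rfl⟩
  have : IsFiniteMeasure (ν.restrict (cyl A b)) := ⟨by simpa using hν b⟩
  have hm := hF.inter (measurableSet_cyl (A := A) b)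
  obtain ⟨n, y, hy, hPy, h0, hle⟩ := exists_measure_cylAt_diff_le (μ := ν.restrict (cyl A b)) hP hm
    (by rwa [Measure.restrict_apply hm, Set.inter_assoc, Set.inter_self])
    (fun x hx => hFP x hx.1) hδ
  have hC := measurableSet_cylAt n y
  have hsub : cylAt n y ⊆ cyl A b := (show y.1 0 = b from hy.2) ▸ cylAt_subset_cyl n y
  rw [Measure.restrict_apply hC, Set.inter_eq_left.2 hsub] at h0 hle
  rw [Measure.restrict_apply (hC.diff hm),
    Set.inter_eq_left.2 (Set.sdiff_subset.trans hsub)] at hle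
  refine ⟨n, y, hy.1, hPy, h0, le_trans (measure_mono ?_) hle⟩
  exact Set.sdiff_subset_sdiff_right Set.inter_subset_left

end
end MarkovShift

/-! ### Lipschitz constants of Birkhoff sums -/

theorem setOf_frequently_mem_eq {X : Type*} (s : ℕ → Set X) :
    {x | ∃ᶠ n in atTop, x ∈ s n} = ⋂ N, ⋃ n ≥ N, s n := by
  ext x
  simp [frequently_atTop]

theorem measurableSet_frequently_mem {X : Type*} [MeasurableSpace X] {s : ℕ → Set X}
    (hs : ∀ n, MeasurableSet (s n)) : MeasurableSet {x | ∃ᶠ n in atTop, x ∈ s n} := by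
  rw [setOf_frequently_mem_eq]
  exact MeasurableSet.iInter fun N => MeasurableSet.biUnion (Set.to_countable _) fun n _ => hs n

theorem le_measure_frequently {X : Type*} [MeasurableSpace X] {μ : Measure X} [IsFiniteMeasure μ]
    {s : ℕ → Set X} (hs : ∀ n, MeasurableSet (s n)) {c : ℝ≥0∞} (hc : ∀ n, c ≤ μ (s n)) :
    c ≤ μ {x | ∃ᶠ n in atTop, x ∈ s n} := by
  have hm : ∀ N, MeasurableSet (⋃ n ≥ N, s n) := fun N =>
    MeasurableSet.biUnion (Set.to_countable _) fun n _ => hs n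
  have hanti : Antitone fun N => ⋃ n ≥ N, s n := fun N N' h =>
    Set.biUnion_subset_biUnion_left fun n hn => le_trans h hn
  rw [setOf_frequently_mem_eq,
    hanti.measure_iInter (fun N => (hm N).nullMeasurableSet) ⟨0, measure_ne_top _ _⟩]
  exact le_iInf fun N => (hc N).trans (measure_mono (Set.subset_biUnion_of_mem (le_refl N)))

namespace MarkovShift

section

variable {S : Type*} {A : S → S → Prop}

/-- If `f` is `C b`-Lipschitz on each `[b]`, this is a Lipschitz constant of the Birkhoff sum
`fₙ`, pulled back to `[xₙ]` by the inverse branch of `T ^ n` along `x₀ … x_{n-1}`. -/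
def lipWeight (τ : ℝ) (C : S → ℝ) (n : ℕ) (x : MarkovShift A) : ℝ :=
  ∑ k ∈ Finset.range n, τ ^ (n - k) * C (x.1 k)

/-- The limit as `n → ∞` of the integrals of `lipWeight τ C n` over `{x | xₙ = a}`, for an
invariant measure `m`. -/
noncomputable def meanLipWeight [MeasurableSpace S] (τ : ℝ) (C : S → ℝ)
    (m : Measure (MarkovShift A)) (a : S) : ℝ≥0∞ :=
  ∑' j : ℕ, ENNReal.ofReal (τ ^ (j + 1)) *
    ∫⁻ x in {x | x.1 (j + 1) = a}, ENNReal.ofReal (C (x.1 0)) ∂m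

theorem lipWeight_congr {τ : ℝ} {C : S → ℝ} {n : ℕ} {x y : MarkovShift A} (h : x ∈ cylAt n y) :
    lipWeight τ C n x = lipWeight τ C n y :=
  Finset.sum_congr rfl fun k hk => by rw [h k (Finset.mem_range.1 hk).le]

theorem exists_dist_le_of_essLip_lt [MeasurableSpace S] {G : Type*} [NormedAddCommGroup G]
    {τ : ℝ} (hτ : 0 ≤ τ) {m : Measure (MarkovShift A)} {f : MarkovShift A → G}
    {Z : Set (MarkovShift A)} {C : ℝ} (h : essLip τ m f Z < ENNReal.ofReal C) :
    ∃ Ω ⊆ Z, m (Z \ Ω) = 0 ∧ ∀ x ∈ Ω, ∀ y ∈ Ω, dist (f x) (f y) ≤ C * sepDist τ x y := by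
  obtain ⟨_, ⟨C', -, rfl, Ω, hΩ, hm, hd⟩, hlt⟩ := sInf_lt_iff.1 h
  have hC : C' ≤ C := (ENNReal.ofReal_lt_ofReal_iff'.1 hlt).1.le
  exact ⟨Ω, hΩ, hm, fun x hx y hy => (hd x hx y hy).trans
    (mul_le_mul_of_nonneg_right hC (sepDist_nonneg hτ x y))⟩

theorem essLip_lt_top_of_measure_eq_zero [MeasurableSpace S] {G : Type*} [NormedAddCommGroup G]
    {τ : ℝ} {m : Measure (MarkovShift A)} {f : MarkovShift A → G} {Z : Set (MarkovShift A)}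
    (h : m Z = 0) : essLip τ m f Z < ⊤ :=
  lt_of_le_of_lt (b := ENNReal.ofReal 1)
    (sInf_le ⟨1, one_pos, rfl, ∅, Set.empty_subset _, by simpa using h, by simp⟩)
    ENNReal.ofReal_lt_top

theorem measurableSet_coord_eq [MeasurableSpace S] [DiscreteMeasurableSpace S] (n : ℕ) (a : S) :
    MeasurableSet {x : MarkovShift A | x.1 n = a} :=
  measurable_coord n (MeasurableSet.of_discrete (s := {a}))

theorem measurable_coord_comp [MeasurableSpace S] [DiscreteMeasurableSpace S]
    (C : S → ℝ) (k : ℕ) :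
    Measurable fun x : MarkovShift A => C (x.1 k) :=
  (Measurable.of_discrete (f := C)).comp (measurable_coord k)

end

section

variable {S : Type*} [MeasurableSpace S] [DiscreteMeasurableSpace S] {A : S → S → Prop}

theorem measurable_lipWeight (τ : ℝ) (C : S → ℝ) (n : ℕ) :
    Measurable (lipWeight τ C n : MarkovShift A → ℝ) :=
  Finset.measurable_fun_sum _ fun k _ => (measurable_coord_comp C k).const_mul _

theorem measurableSet_coord_eq_and_lipWeight_le (τ : ℝ) (C : S → ℝ) (n : ℕ) (a : S) (M : ℝ) :
    MeasurableSet {x : MarkovShift A | x.1 n = a ∧ lipWeight τ C n x ≤ M} :=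
  (measurableSet_coord_eq n a).inter (measurable_lipWeight τ C n measurableSet_Iic)

theorem tsum_setLIntegral_coord [Countable S] (m : Measure (MarkovShift A)) (n : ℕ)
    (g : MarkovShift A → ℝ≥0∞) :
    ∑' a, ∫⁻ x in {x | x.1 n = a}, g x ∂m = ∫⁻ x, g x ∂m := by
  have hU : ⋃ a, {x : MarkovShift A | x.1 n = a} = Set.univ := by
    ext x
    simp
  rw [← setLIntegral_univ, ← hU, lintegral_iUnion (measurableSet_coord_eq n)]
  intro a b hab
  exact Set.disjoint_left.2 fun x hx hx' => hab (hx.symm.trans hx')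

theorem lintegral_coord_zero [Countable S] (m : Measure (MarkovShift A)) (C : S → ℝ) :
    ∫⁻ x, ENNReal.ofReal (C (x.1 0)) ∂m = ∑' a, m (cyl A a) * ENNReal.ofReal (C a) := by
  rw [← tsum_setLIntegral_coord m 0]
  refine tsum_congr fun a => ?_
  rw [setLIntegral_congr_fun (g := fun _ => ENNReal.ofReal (C a)) (measurableSet_coord_eq 0 a)
    (fun x hx => by rw [show x.1 0 = a from hx]), setLIntegral_const, mul_comm]
  rfl

theorem tsum_meanLipWeight_lt_top [Countable S] {τ : ℝ} (hτ0 : 0 ≤ τ) (hτ1 : τ < 1)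
    {C : S → ℝ} {m : Measure (MarkovShift A)}
    (hC : ∑' a, m (cyl A a) * ENNReal.ofReal (C a) < ⊤) :
    ∑' a, meanLipWeight τ C m a < ⊤ := by
  unfold meanLipWeight
  rw [ENNReal.tsum_comm]
  simp_rw [ENNReal.tsum_mul_left, tsum_setLIntegral_coord, lintegral_coord_zero]
  rw [ENNReal.tsum_mul_right]
  refine ENNReal.mul_lt_top ?_ hC
  have := (summable_geometric_of_lt_one hτ0 hτ1).comp_injective (add_left_injective 1)
  exact lt_top_iff_ne_top.2 this.tsum_ofReal_ne_top

theorem setLIntegral_lipWeight_le {τ : ℝ} (hτ : 0 ≤ τ) {C : S → ℝ} (hC : ∀ b, 0 ≤ C b)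
    {m : Measure (MarkovShift A)} (hinv : MeasurePreserving (shift (A := A)) m m) (n : ℕ) (a : S) :
    ∫⁻ x in {x | x.1 n = a}, ENNReal.ofReal (lipWeight τ C n x) ∂m ≤ meanLipWeight τ C m a := by
  set I : ℕ → ℝ≥0∞ := fun j => ENNReal.ofReal (τ ^ (j + 1)) *
    ∫⁻ x in {x : MarkovShift A | x.1 (j + 1) = a}, ENNReal.ofReal (C (x.1 0)) ∂m with hI
  have h1 : ∀ x : MarkovShift A, ENNReal.ofReal (lipWeight τ C n x) =
      ∑ k ∈ Finset.range n, ENNReal.ofReal (τ ^ (n - k)) * ENNReal.ofReal (C (x.1 k)) := by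
    intro x
    rw [lipWeight, ENNReal.ofReal_sum_of_nonneg fun k _ => mul_nonneg (pow_nonneg hτ _) (hC _)]
    exact Finset.sum_congr rfl fun k _ => ENNReal.ofReal_mul (pow_nonneg hτ _)
  calc ∫⁻ x in {x | x.1 n = a}, ENNReal.ofReal (lipWeight τ C n x) ∂m
      = ∑ k ∈ Finset.range n, I (n - 1 - k) := by
        simp_rw [h1]
        rw [lintegral_finsetSum _ fun k _ =>
          (measurable_coord_comp C k).ennreal_ofReal.const_mul _]
        refine Finset.sum_congr rfl fun k hk => ?_
        have hk' : k < n := Finset.mem_range.1 hk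
        have h2 : n - 1 - k + 1 = n - k := by omega
        rw [lintegral_const_mul _ (measurable_coord_comp C k).ennreal_ofReal]
        simp only [hI, h2]
        congr 1
        rw [← (hinv.iterate k).setLIntegral_comp_preimage (measurableSet_coord_eq (n - k) a)
          (measurable_coord_comp C 0).ennreal_ofReal]
        simp [Nat.sub_add_cancel hk'.le]
    _ = ∑ j ∈ Finset.range n, I j := Finset.sum_range_reflect I n
    _ ≤ ∑' j, I j := ENNReal.sum_le_tsum _

/-- Markov's inequality: with probability at least `m [a] / 2`, one has both `xₙ = a` and a bound on
`lipWeight` that is uniform in `n`. -/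
theorem half_measure_cyl_le {τ : ℝ} (hτ : 0 ≤ τ) {C : S → ℝ} (hC : ∀ b, 0 ≤ C b)
    {m : Measure (MarkovShift A)} [IsFiniteMeasure m]
    (hinv : MeasurePreserving (shift (A := A)) m m) {a : S} (ha : m (cyl A a) ≠ 0) {M : ℝ}
    (hM : 2 * meanLipWeight τ C m a / m (cyl A a) + 1 ≤ ENNReal.ofReal M) (n : ℕ) :
    m (cyl A a) / 2 ≤ m {x | x.1 n = a ∧ lipWeight τ C n x ≤ M} := by
  set s := {x : MarkovShift A | x.1 n = a} with hs
  have hsm : MeasurableSet s := measurableSet_coord_eq n a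
  have hms : m s = m (cyl A a) := by
    rw [← (hinv.iterate n).measure_preimage (measurableSet_cyl a).nullMeasurableSet]
    congr 1
    ext x
    simp [hs, cyl]
  have hne : m (cyl A a) ≠ ⊤ := measure_ne_top _ _
  have hM0 : ENNReal.ofReal M ≠ 0 := fun h => by simp [h] at hM
  have hbad : m (s ∩ {x | ENNReal.ofReal M ≤ ENNReal.ofReal (lipWeight τ C n x)}) ≤
      m (cyl A a) / 2 := by
    have h1 := mul_meas_ge_le_lintegral (μ := m.restrict s)
      (measurable_lipWeight (A := A) τ C n).ennreal_ofReal (ENNReal.ofReal M)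
    rw [Measure.restrict_apply' hsm, Set.inter_comm] at h1
    have h2 := h1.trans (setLIntegral_lipWeight_le hτ hC hinv n a)
    rw [← ENNReal.mul_le_mul_iff_right hM0 ENNReal.ofReal_ne_top]
    refine h2.trans ?_
    calc meanLipWeight τ C m a
        = 2 * meanLipWeight τ C m a / m (cyl A a) * (m (cyl A a) / 2) := by
          have h3 : 2 * meanLipWeight τ C m a / m (cyl A a) * (m (cyl A a) / 2) =
              meanLipWeight τ C m a * ((m (cyl A a))⁻¹ * m (cyl A a)) * (2 * 2⁻¹) := by
            simp only [div_eq_mul_inv]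
            ring
          rw [h3, ENNReal.inv_mul_cancel ha hne, ENNReal.mul_inv_cancel two_ne_zero
            ENNReal.ofNat_ne_top, mul_one, mul_one]
      _ ≤ ENNReal.ofReal M * (m (cyl A a) / 2) := by
          gcongr
          exact le_self_add.trans hM
  have hcov : s ⊆ {x | x.1 n = a ∧ lipWeight τ C n x ≤ M} ∪
      (s ∩ {x | ENNReal.ofReal M ≤ ENNReal.ofReal (lipWeight τ C n x)}) := by
    intro x hx
    rcases le_total (lipWeight τ C n x) M with h | h
    · exact Or.inl ⟨hx, h⟩
    · exact Or.inr ⟨hx, ENNReal.ofReal_le_ofReal h⟩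
  have h3 := (measure_mono (μ := m) hcov).trans (measure_union_le _ _)
  rw [hms] at h3
  have h4 : m (cyl A a) / 2 + m (cyl A a) / 2 ≤
      m {x | x.1 n = a ∧ lipWeight τ C n x ≤ M} + m (cyl A a) / 2 := by
    rw [ENNReal.add_halves]
    exact h3.trans (by gcongr)
  exact (ENNReal.add_le_add_iff_right (ENNReal.div_lt_top hne two_ne_zero).ne).1 h4

end
end MarkovShift

/-! ### Lipschitz constants of the transfer function -/

namespace MarkovShift

section

variable {S : Type*} {A : S → S → Prop}

/-- If `f = u - u ∘ T` along the orbits of `z` and `z'`, whose first `n` coordinates follow `y`,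
then the variation of `u` at time `n` is controlled by that at time `0` and by `lipWeight`. -/
theorem dist_le_of_iterate_shift {G : Type*} [NormedAddCommGroup G] {τ : ℝ} {C : S → ℝ}
    {Ω : S → Set (MarkovShift A)} {f u : MarkovShift A → G}
    (hΩ : ∀ b, ∀ x ∈ Ω b, ∀ y ∈ Ω b, dist (f x) (f y) ≤ C b * sepDist τ x y)
    {n : ℕ} {y z z' : MarkovShift A} (hz : z ∈ cylAt n y) (hz' : z' ∈ cylAt n y)
    (hg : ∀ k, f (shift^[k] z) = u (shift^[k] z) - u (shift (shift^[k] z)) ∧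
      shift^[k] z ∈ Ω (z.1 k))
    (hg' : ∀ k, f (shift^[k] z') = u (shift^[k] z') - u (shift (shift^[k] z')) ∧
      shift^[k] z' ∈ Ω (z'.1 k)) :
    dist (u (shift^[n] z)) (u (shift^[n] z')) ≤
      dist (u z) (u z') + lipWeight τ C n y * sepDist τ (shift^[n] z) (shift^[n] z') := by
  have htel : ∀ w : MarkovShift A,
      (∀ k, f (shift^[k] w) = u (shift^[k] w) - u (shift (shift^[k] w)) ∧
        shift^[k] w ∈ Ω (w.1 k)) →
      u (shift^[n] w) = u w - ∑ k ∈ Finset.range n, f (shift^[k] w) := by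
    intro w hw
    have h1 : ∀ k, f (shift^[k] w) = u (shift^[k] w) - u (shift^[k + 1] w) := fun k => by
      rw [Function.iterate_succ_apply']
      exact (hw k).1
    simp_rw [h1]
    rw [Finset.sum_range_sub' (fun k => u (shift^[k] w))]
    simp
  rw [htel z hg, htel z' hg']
  refine (dist_sub_sub_le _ _ _ _).trans (add_le_add le_rfl ?_)
  refine (dist_sum_sum_le _ _ _).trans ?_
  rw [lipWeight, Finset.sum_mul]
  refine Finset.sum_le_sum fun k hk => ?_
  have hk' : k < n := Finset.mem_range.1 hk
  have h1 : z.1 k = y.1 k := hz k hk'.le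
  have h2 : z'.1 k = y.1 k := hz' k hk'.le
  refine (hΩ (y.1 k) _ (h1 ▸ (hg k).2) _ (h2 ▸ (hg' k).2)).trans (le_of_eq ?_)
  rw [sepDist_eq_pow_mul (n := n - k) (x := shift^[k] z) (y := shift^[k] z') fun i hi => ?_]
  · rw [← Function.iterate_add_apply, ← Function.iterate_add_apply, Nat.sub_add_cancel hk'.le]
    ring
  · rw [iterate_shift_apply, iterate_shift_apply, hz (i + k) (by omega), hz' (i + k) (by omega)]

end

section

variable {S : Type*} [Countable S] [TopologicalSpace S] [DiscreteTopology S] [MeasurableSpace S]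
  [DiscreteMeasurableSpace S] {A : S → S → Prop} {G : Type*} [NormedAddCommGroup G]
  [LocallyCompactSpace G] [MeasurableSpace G] [BorelSpace G]

/-- One inverse branch: `u` is `M`-Lipschitz up to the error `2 * ε` on `[a]`, outside a set of
small measure. The word `y₀ … y_{n-1}` defining the branch is such that `u` is almost constant on
most of the cylinder around `y`. -/
theorem exists_measure_le_and_dist_le {φ : MarkovShift A → ℝ} (hφ : IsLocallyHolder φ) {lam : ℝ}
    {ν : Measure (MarkovShift A)} (hνa : ∀ a, ν (cyl A a) < ⊤)
    (hν : ∀ F : MarkovShift A → ℝ≥0∞, Measurable F →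
      ∫⁻ x, ruelleOp φ F x ∂ν = ENNReal.ofReal lam * ∫⁻ x, F x ∂ν)
    {m : Measure (MarkovShift A)} [IsFiniteMeasure m] (hmν : m ≪ ν)
    (hinv : MeasurePreserving (shift (A := A)) m m) {τ : ℝ} (hτ : 0 ≤ τ) {C : S → ℝ}
    {Ω : S → Set (MarkovShift A)} {f u : MarkovShift A → G} (hΩm : ∀ b, m (cyl A b \ Ω b) = 0)
    (hΩ : ∀ b, ∀ x ∈ Ω b, ∀ y ∈ Ω b, dist (f x) (f y) ≤ C b * sepDist τ x y)
    (hu : Measurable u) (hfu : ∀ᵐ x ∂m, f x = u x - u (shift x)) {a : S} {M : ℝ}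
    (hM : m {x | ∃ᶠ n in atTop, x.1 n = a ∧ lipWeight τ C n x ≤ M} ≠ 0)
    {ε : ℝ} (hε : 0 < ε) {η : ℝ≥0∞} (hη : η ≠ 0) :
    ∃ B : Set (MarkovShift A), ν B ≤ η ∧ ∀ x ∈ cyl A a \ B, ∀ x' ∈ cyl A a \ B,
      dist (u x) (u x') ≤ 2 * ε + M * sepDist τ x x' := by
  obtain ⟨D, hD, hdist⟩ := exists_measure_branch_notMem_mul_le hφ hν
  have : StandardBorelSpace (MarkovShift A) := standardBorelSpace_markovShift
  -- The points whose whole orbit satisfies the coboundary equation and stays in the sets `Ω b`.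
  have hgood : ∀ᵐ z ∂m, ∀ k, f (shift^[k] z) = u (shift^[k] z) - u (shift (shift^[k] z)) ∧
      shift^[k] z ∈ Ω (z.1 k) := by
    have h1 : ∀ᵐ x ∂m, x ∈ Ω (x.1 0) := by
      rw [ae_iff]
      refine measure_mono_null (t := ⋃ b, cyl A b \ Ω b) (fun x hx => ?_) (measure_iUnion_null hΩm)
      exact Set.mem_iUnion.2 ⟨x.1 0, rfl, hx⟩
    refine ae_all_iff.2 fun k => ?_
    filter_upwards [(hinv.iterate k).quasiMeasurePreserving.ae hfu,
      (hinv.iterate k).quasiMeasurePreserving.ae h1] with z hz1 hz2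
    exact ⟨hz1, by simpa using hz2⟩
  obtain ⟨N, hgN, hNm, hN0⟩ := exists_measurable_superset_of_null (ae_iff.1 hgood)
  set L := {x : MarkovShift A | ∃ᶠ n in atTop, x.1 n = a ∧ lipWeight τ C n x ≤ M}
  have hL : MeasurableSet L := measurableSet_frequently_mem fun n =>
    measurableSet_coord_eq_and_lipWeight_le τ C n a M
  obtain ⟨p, hp⟩ := exists_measure_inter_preimage_ball_ne_zero m hu hL hM hε
  set F := (L ∩ u ⁻¹' Metric.ball p ε) \ N
  have hF : MeasurableSet F := (hL.inter (hu measurableSet_ball)).diff hNm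
  have hFν : ν F ≠ 0 := fun h => hp (by rw [← measure_sdiff_null hN0]; exact hmν h)
  -- The proportion `δ` left out of the cylinder is chosen so that its image in `[a]`, under the
  -- bounded distortion of `ν`, has measure at most `η`.
  set δ := η / (D * ν (cyl A a) + 1)
  have hden : D * ν (cyl A a) + 1 ≠ ⊤ :=
    ENNReal.add_ne_top.2 ⟨ENNReal.mul_ne_top hD (hνa a).ne, ENNReal.one_ne_top⟩
  have hδ : δ ≠ 0 := ENNReal.div_ne_zero.2 ⟨hη, hden⟩
  obtain ⟨n, y, -, ⟨hya, hyM⟩, h0, hle⟩ := exists_measure_cylAt_diff_le_of_cyl hνa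
    (P := fun n x => x.1 n = a ∧ lipWeight τ C n x ≤ M)
    (fun n y z hz hy => ⟨(hz n le_rfl).trans hy.1, (lipWeight_congr hz).trans_le hy.2⟩) hF hFν
    (fun x hx => hx.1.1) hδ
  have htop : ν (cylAt n y) ≠ ⊤ :=
    ((measure_mono (cylAt_subset_cyl n y)).trans_lt (hνa _)).ne
  refine ⟨{x ∈ cyl A a | branch n y x ∉ F}, ?_, ?_⟩
  · have h1 := hdist n y F hF
    rw [hya] at h1
    rw [← ENNReal.mul_le_mul_iff_left h0 htop]
    calc ν {x ∈ cyl A a | branch n y x ∉ F} * ν (cylAt n y)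
        ≤ D * ν (cyl A a) * (δ * ν (cylAt n y)) := h1.trans (by gcongr)
      _ = D * ν (cyl A a) * δ * ν (cylAt n y) := by ring
      _ ≤ (D * ν (cyl A a) + 1) * δ * ν (cylAt n y) := by gcongr; exact le_self_add
      _ = η * ν (cylAt n y) := by
        rw [ENNReal.mul_div_cancel (by simp) hden]
  · have hbr : ∀ x ∈ cyl A a \ {x ∈ cyl A a | branch n y x ∉ F},
        x.1 0 = y.1 n ∧ branch n y x ∈ F := fun x hx =>
      ⟨(show x.1 0 = a from hx.1).trans hya.symm, not_not.1 fun h => hx.2 ⟨hx.1, h⟩⟩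
    intro x hx x' hx'
    obtain ⟨hxy, hxF⟩ := hbr x hx
    obtain ⟨hxy', hxF'⟩ := hbr x' hx'
    have hNg : ∀ z ∈ F, ∀ k, f (shift^[k] z) = u (shift^[k] z) - u (shift (shift^[k] z)) ∧
        shift^[k] z ∈ Ω (z.1 k) := fun z hz => not_not.1 fun h => hz.2 (hgN h)
    have h1 := dist_le_of_iterate_shift hΩ (branch_mem_cylAt hxy) (branch_mem_cylAt hxy')
      (hNg _ hxF) (hNg _ hxF')
    rw [iterate_shift_branch hxy, iterate_shift_branch hxy'] at h1
    have h2 : dist (u (branch n y x)) (u (branch n y x')) ≤ 2 * ε := by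
      have h3 : dist (u (branch n y x)) p < ε := hxF.1.2
      have h4 : dist (u (branch n y x')) p < ε := hxF'.1.2
      have h5 := dist_triangle_right (u (branch n y x)) (u (branch n y x')) p
      linarith
    exact h1.trans (add_le_add h2 (mul_le_mul_of_nonneg_right hyM (sepDist_nonneg hτ x x')))

/-- If a positive measure of points visit `[a]` infinitely often at times at which `lipWeight` is
at most `M`, then `u` is `M`-Lipschitz on `[a]`: by the Borel–Cantelli lemma, the errors of
`exists_measure_le_and_dist_le` disappear in the limit. -/
theorem essLip_le_of_frequently {φ : MarkovShift A → ℝ} (hφ : IsLocallyHolder φ) {lam : ℝ}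
    {ν : Measure (MarkovShift A)} (hνa : ∀ a, ν (cyl A a) < ⊤)
    (hν : ∀ F : MarkovShift A → ℝ≥0∞, Measurable F →
      ∫⁻ x, ruelleOp φ F x ∂ν = ENNReal.ofReal lam * ∫⁻ x, F x ∂ν)
    {m : Measure (MarkovShift A)} [IsFiniteMeasure m] (hmν : m ≪ ν)
    (hinv : MeasurePreserving (shift (A := A)) m m) {τ : ℝ} (hτ : 0 ≤ τ) {C : S → ℝ}
    {Ω : S → Set (MarkovShift A)} {f u : MarkovShift A → G} (hΩm : ∀ b, m (cyl A b \ Ω b) = 0)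
    (hΩ : ∀ b, ∀ x ∈ Ω b, ∀ y ∈ Ω b, dist (f x) (f y) ≤ C b * sepDist τ x y)
    (hu : Measurable u) (hfu : ∀ᵐ x ∂m, f x = u x - u (shift x)) {a : S} {M : ℝ} (hM0 : 0 < M)
    (hM : m {x | ∃ᶠ n in atTop, x.1 n = a ∧ lipWeight τ C n x ≤ M} ≠ 0) :
    essLip τ m u (cyl A a) ≤ ENNReal.ofReal M := by
  choose B hB hBu using fun j : ℕ => exists_measure_le_and_dist_le hφ hνa hν hmν hinv hτ hΩm hΩ hu
    hfu hM (ε := (1 / 2) ^ j) (by positivity) (η := 2⁻¹ ^ j)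
    (pow_ne_zero _ (ENNReal.inv_ne_zero.2 ENNReal.ofNat_ne_top))
  have hsum : ∑' j, ν (B j) ≠ ⊤ := by
    refine ne_top_of_le_ne_top ?_ (ENNReal.tsum_le_tsum hB)
    rw [ENNReal.tsum_geometric, ENNReal.one_sub_inv_two, inv_inv]
    exact ENNReal.ofNat_ne_top
  have hBC := hmν.ae_le (ae_eventually_notMem hsum)
  refine sInf_le ⟨M, hM0, rfl, {x ∈ cyl A a | ∀ᶠ j in atTop, x ∉ B j}, fun x hx => hx.1, ?_, ?_⟩
  · refine measure_mono_null ?_ (ae_iff.1 hBC)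
    rintro x ⟨hx, hx'⟩ h
    exact hx' ⟨hx, h⟩
  · rintro x ⟨hxa, hx⟩ x' ⟨hxa', hx'⟩
    have hlim : Tendsto (fun j : ℕ => 2 * (1 / 2 : ℝ) ^ j + M * sepDist τ x x') atTop
        (nhds (M * sepDist τ x x')) := by
      simpa using ((tendsto_pow_atTop_nhds_zero_of_lt_one (r := (1 / 2 : ℝ)) (by norm_num)
        (by norm_num)).const_mul 2).add_const (M * sepDist τ x x')
    refine ge_of_tendsto hlim ?_
    filter_upwards [hx, hx'] with j hj hj'
    exact hBu j x ⟨hxa, hj⟩ x' ⟨hxa', hj'⟩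

end
end MarkovShift

/-! ### Summability of the Lipschitz constants -/

theorem mainTheorem6 {S : Type*} [Countable S]
    [TopologicalSpace S] [DiscreteTopology S] [MeasurableSpace S] [DiscreteMeasurableSpace S]
    (A : S → S → Prop)
    (φ : MarkovShift A → ℝ) (hφ : MarkovShift.IsLocallyHolder φ)
    (lam : ℝ) (hrec : MarkovShift.IsPositiveRecurrent φ lam)
    (m : Measure (MarkovShift A)) [IsProbabilityMeasure m]
    (hm : MarkovShift.IsRPFMeasure φ lam m)
    (hinv : MeasurePreserving (MarkovShift.shift (A := A)) m m)
    (τ : ℝ) (hτ0 : 0 < τ) (hτ1 : τ < 1)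
    {G : Type*} [NormedAddCommGroup G] [LocallyCompactSpace G]
    [MeasurableSpace G] [BorelSpace G]
    (f : MarkovShift A → G)
    (hf : ∑' a : S, m (MarkovShift.cyl A a) *
      MarkovShift.essLip τ m f (MarkovShift.cyl A a) < ⊤)
    (u : MarkovShift A → G) (hu : Measurable u)
    (hfu : ∀ᵐ x ∂m, f x = u x - u (MarkovShift.shift x)) :
    (∀ a : S, MarkovShift.essLip τ m u (MarkovShift.cyl A a) < ⊤) ∧
    (MarkovShift.IsTransitive m →
      ∑' a : S, m (MarkovShift.cyl A a) *
        MarkovShift.essLip τ m u (MarkovShift.cyl A a) < ⊤) := by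
  obtain ⟨h, ν, -, -, -, hνa, hν, rfl⟩ := hm
  set m := ν.withDensity fun x => ENNReal.ofReal (h x)
  have hmν : m ≪ ν := withDensity_absolutelyContinuous _ _
  have hftop : ∀ b, MarkovShift.essLip τ m f (MarkovShift.cyl A b) < ⊤ := by
    intro b
    by_cases hb : m (MarkovShift.cyl A b) = 0
    · exact MarkovShift.essLip_lt_top_of_measure_eq_zero hb
    · exact ENNReal.lt_top_of_mul_ne_top_right (ENNReal.ne_top_of_tsum_ne_top hf.ne b) hb
  -- The infimum defining `essLip` need not be attained; adding `1` gives an attained constant and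
  -- keeps the sum finite, as `m` is a probability measure.
  set C : S → ℝ := fun b => (MarkovShift.essLip τ m f (MarkovShift.cyl A b)).toReal + 1
  have hC0 : ∀ b, 0 ≤ C b := fun b => by positivity
  have hCe : ∀ b, ENNReal.ofReal (C b) = MarkovShift.essLip τ m f (MarkovShift.cyl A b) + 1 := by
    intro b
    rw [ENNReal.ofReal_add ENNReal.toReal_nonneg zero_le_one, ENNReal.ofReal_toReal (hftop b).ne,
      ENNReal.ofReal_one]
  have hone : ∑' a, m (MarkovShift.cyl A a) = 1 := by
    have h1 := MarkovShift.lintegral_coord_zero m (fun _ => 1)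
    simpa using h1.symm
  choose Ω _ hΩm hΩ using fun b => MarkovShift.exists_dist_le_of_essLip_lt hτ0.le
    (C := C b) (by rw [hCe]; exact ENNReal.lt_add_right (hftop b).ne one_ne_zero)
  have hCsum : ∑' a, m (MarkovShift.cyl A a) * ENNReal.ofReal (C a) < ⊤ := by
    simp_rw [hCe, mul_add, mul_one]
    rw [ENNReal.tsum_add, hone]
    exact ENNReal.add_lt_top.2 ⟨hf, ENNReal.one_lt_top⟩
  have hJ := MarkovShift.tsum_meanLipWeight_lt_top hτ0.le hτ1 hCsum
  have hbound : ∀ a, m (MarkovShift.cyl A a) ≠ 0 →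
      MarkovShift.essLip τ m u (MarkovShift.cyl A a) ≤
        2 * MarkovShift.meanLipWeight τ C m a / m (MarkovShift.cyl A a) + 1 ∧
      2 * MarkovShift.meanLipWeight τ C m a / m (MarkovShift.cyl A a) + 1 < ⊤ := by
    intro a ha
    set q := 2 * MarkovShift.meanLipWeight τ C m a / m (MarkovShift.cyl A a) + 1
    have hq : q < ⊤ := by
      refine ENNReal.add_lt_top.2 ⟨ENNReal.div_lt_top ?_ ha, ENNReal.one_lt_top⟩
      exact ENNReal.mul_ne_top ENNReal.ofNat_ne_top (ENNReal.ne_top_of_tsum_ne_top hJ.ne a)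
    have hq0 : 0 < q.toReal := ENNReal.toReal_pos (by simp [q]) hq.ne
    refine ⟨?_, hq⟩
    rw [← ENNReal.ofReal_toReal hq.ne]
    refine MarkovShift.essLip_le_of_frequently hφ hνa hν hmν hinv hτ0.le hΩm hΩ hu hfu hq0 ?_
    have h1 := le_measure_frequently (μ := m)
      (s := fun n => {x | x.1 n = a ∧ MarkovShift.lipWeight τ C n x ≤ q.toReal})
      (fun n => MarkovShift.measurableSet_coord_eq_and_lipWeight_le τ C n a q.toReal)
      (MarkovShift.half_measure_cyl_le hτ0.le hC0 hinv ha (ENNReal.ofReal_toReal hq.ne).ge)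
    exact ((ENNReal.half_pos ha).trans_le h1).ne'
  refine ⟨fun a => ?_, fun _ => ?_⟩
  · by_cases ha : m (MarkovShift.cyl A a) = 0
    · exact MarkovShift.essLip_lt_top_of_measure_eq_zero ha
    · exact (hbound a ha).1.trans_lt (hbound a ha).2
  · have hle : ∀ a, m (MarkovShift.cyl A a) * MarkovShift.essLip τ m u (MarkovShift.cyl A a) ≤
        2 * MarkovShift.meanLipWeight τ C m a + m (MarkovShift.cyl A a) := by
      intro a
      by_cases ha : m (MarkovShift.cyl A a) = 0
      · simp [ha]
      · refine (mul_le_mul' le_rfl (hbound a ha).1).trans (le_of_eq ?_)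
        rw [mul_add, mul_one, ENNReal.mul_div_cancel ha (measure_ne_top _ _)]
    refine (ENNReal.tsum_le_tsum hle).trans_lt ?_
    rw [ENNReal.tsum_add, ENNReal.tsum_mul_left, hone]
    exact ENNReal.add_lt_top.2 ⟨ENNReal.mul_lt_top ENNReal.ofNat_lt_top hJ, ENNReal.one_lt_top⟩
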